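/- **Setting.** Let $f,g_1,\dots,g_r\in\mathbb R[x_1,\dots,x_n]$, where $f$ has no constant term, $f=\sum_{\alpha\neq 0} b_\alpha x^\alpha$, and let $K=\{x\in\mathbb R^n: g_i(x)\ge 0,\ i=1,\dots,r\}$. Put $g_0=1$ and $\tilde w_i=\lceil \deg g_i/2\rceil$ (so $\tilde w_0=0$), and $s(e)=\binom{n+e}{e}$. Assume that $K$ is compact and that $p_K^*=\min_{x\in K}f(x)$ exists (i.e. $K\ne\emptyset$). Fix positive integers $l_0,\dots,l_r$. A *level* is an integer $N\ge 1$ with $2N\ge\deg f$, $2N\ge\deg g_i$ for all $i$, and $l_i\mid s(N-\tilde w_i)$ for $i=0,\dots,r$; write $s(N-\tilde w_i)=m_il_i$. *Tensors.* For an $m\times p\times l$ real (or polynomial) tensor $\mathcal A$ with frontal slices $A^{(1)},\dots,A^{(l)}$, $\mathrm{bcirc}(\mathcal A)$ is the block circulant $ml\times pl$ matrix with first block column $A^{(1)},\dots,A^{(l)}$, $\mathrm{unfold}(\mathcal A)$ is that first block column, and $\mathrm{fold}_l$ is the inverse of $\mathrm{unfold}$. Further $\mathcal A*\mathcal B=\mathrm{fold}_l(\mathrm{bcirc}(\mathcal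 A)\,\mathrm{unfold}(\mathcal B))$; $\mathcal A^{\mathsf T}$ is obtained by transposing all slices and reversing the order of slices $2,\dots,l$; $\langle\cdot,\cdot\rangle$ is the entrywise inner product; and $\mathcal A\succeq_{\mathcal T}\mathcal O$ means that $\mathcal A^{\mathsf T}=\mathcal A$ and $\langle\mathcal X,\mathcal A*\mathcal X\rangle\ge0$ for all $\mathcal X\in\mathbb R^{m\times1\times l}$. A tensor $\mathcal A$ is a *subtensor* of $\mathcal B$ (with the same number $l$ of slices) if one common selection of rows and columns carries every slice of $\mathcal B$ to the slice of $\mathcal A$ with the same number. *Monomials.* For every level $N$ and every $i=0,\dots,r$ choose an ordering of the vector $[x]_{N-\tilde w_i}$ of all monomials of degree at most $N-\tilde w_i$, and let $\mathcal X_i=\mathcal X_i^N=\mathrm{fold}_{l_i}([x]_{N-\tilde w_i})$. The orderings are *nested* if $\mathcal X_i^N$ is a subtensor of $\mathcal X_i^{N'}$ for all levels $N\le N'$ and all $i$. An *$l_i$-block circulant SOS polynomial* of degree at most $2(N-\tilde w_i)$ is a polynomial $\sum_{k=1}^{t}\sum_{j=1}^{l_i}\big((v^k_j)^{\mathsf T}[x]_{N-\tilde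 w_i}\big)^2$, where $v^k_j$ is the $j$-th column of $\mathrm{bcirc}(\mathrm{fold}_{l_i}(v^k))$ for some generators $v^1,\dots,v^t\in\mathbb R^{s(N-\tilde w_i)}$. A polynomial $h$ has a *certificate of level $N$* if $h=q_0+\sum_{i=1}^r g_iq_i$ as polynomials, where each $q_i$, $i=0,\dots,r$, is an $l_i$-block circulant SOS polynomial of degree at most $2(N-\tilde w_i)$. *Relaxations.* Let $\mathcal D_{i\alpha}\in\mathbb R^{m_i\times m_i\times l_i}$ be the coefficient tensors in $g_i\,\mathcal X_i*\mathcal X_i^{\mathsf T}=\sum_{|\alpha|\le2N}\mathcal D_{i\alpha}x^\alpha$. Consider $$(\mathbb Q_N)\quad \sup\ -\sum_{i=0}^r\langle\mathcal Z_i,\mathcal D_{i0}\rangle\quad\text{s.t.}\quad \sum_{i=0}^r\langle\mathcal Z_i,\mathcal D_{i\alpha}\rangle=b_\alpha\ (0<|\alpha|\le2N),\quad \mathcal Z_i\succeq_{\mathcal T}\mathcal O\ (0\le i\le r),$$ $$(\mathbb Q_N)^*\quad \inf\ \sum_{0<|\alpha|\le2N}b_\alpha y_\alpha\quad\text{s.t.}\quad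 \mathcal D_{i0}+\sum_{0<|\alpha|\le2N}y_\alpha\mathcal D_{i\alpha}\succeq_{\mathcal T}\mathcal O\ (0\le i\le r),$$ with optimal values in $[-\infty,\infty]$. **Theorem.** Assume that for every $\epsilon>0$ the polynomial $f-p_K^*+\epsilon$ has a certificate of some level $N$ (which may depend on $\epsilon$). (a) If the orderings of the monomial vectors are nested, then $\inf(\mathbb Q_N)^*$ and $\sup(\mathbb Q_N)$ are nondecreasing in $N$ and both converge to $p_K^*$ as $N\to\infty$, where $N$ runs through the levels. Moreover (for arbitrary orderings), if $K$ has nonempty interior, then for all sufficiently large levels $N$ there is no duality gap: $\sup(\mathbb Q_N)=\inf(\mathbb Q_N)^*$. (b) If $N$ is a level such that $f-p_K^*$ has a certificate of level $N$ (for arbitrary orderings), then $$\min(\mathbb Q_N)^*=p_K^*=\max(\mathbb Q_N),$$ both values being attained, and for every minimizer $x^*$ of $f$ on $K$ the vector $y^*=((x^*)^\alpha)_{0<|\alpha|\le2N}$ is an optimal solution of $(\mathbb Q_N)^*$. -/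

import Mathlib

open Filter Topology

noncomputable section

/-! ### Third-order tensors -/

/-- An `m × p × l` third-order tensor over `R`, as the stack of its `l` frontal slices
(numbered from `0` to `l - 1`). -/
abbrev Tensor (m p l : ℕ) (R : Type*) := Fin l → Matrix (Fin m) (Fin p) R

namespace Tensor

variable {m p q l : ℕ} {R : Type*}

/-- The block circulant matrix of a tensor: block `(i, j)` is the frontal slice with number
`i - j` modulo `l`. Rows of the `ml × pl` matrix are indexed by (block, row in the block). -/
def bcirc (A : Tensor m p l R) : Matrix (Fin l × Fin m) (Fin l × Fin p) R :=
  Matrix.of fun x y => A (x.1 - y.1) x.2 y.2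

/-- The frontal slices on top of one another. -/
def unfold (A : Tensor m p l R) : Matrix (Fin l × Fin m) (Fin p) R :=
  Matrix.of fun x b => A x.1 x.2 b

/-- The inverse of `unfold`. -/
def fold (M : Matrix (Fin l × Fin m) (Fin p) R) : Tensor m p l R :=
  fun k => Matrix.of fun a b => M (k, a) b

/-- The product of third-order tensors. -/
def tprod [CommSemiring R] (A : Tensor m p l R) (B : Tensor p q l R) : Tensor m q l R :=
  fold (bcirc A * unfold B)

/-- Transpose every frontal slice and reverse the order of the slices other than the first. -/
def transpose [NeZero l] (A : Tensor m p l R) : Tensor p m l R :=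
  fun k => (A (-k)).transpose

/-- The entrywise inner product of real tensors. -/
def inner (A B : Tensor m p l ℝ) : ℝ :=
  ∑ k, ∑ a, ∑ b, A k a b * B k a b

/-- `A ⪰ 0`: the tensor is symmetric and `⟨X, A * X⟩ ≥ 0` for all `m × 1 × l` tensors `X`. -/
def IsPSD [NeZero l] (A : Tensor m m l ℝ) : Prop :=
  A.transpose = A ∧ ∀ X : Tensor m 1 l ℝ, 0 ≤ inner X (tprod A X)

/-- `A` is a subtensor of `B`: all frontal slices of `A` arise from the frontal slices of `B`
with the same number, by one and the same selection of rows and columns. -/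
def IsSubtensor {m' p' : ℕ} (A : Tensor m p l R) (B : Tensor m' p' l R) : Prop :=
  ∃ (σ : Fin m ↪ Fin m') (τ : Fin p ↪ Fin p'), ∀ k, A k = (B k).submatrix σ τ

end Tensor

/-! ### Monomials and block circulant SOS polynomials -/

/-- The exponents `α ∈ ℕⁿ` with `|α| ≤ e`. -/
def expo (n e : ℕ) : Finset (Fin n →₀ ℕ) :=
  (Finset.range (e + 1)).biUnion fun k => Finset.univ.finsuppAntidiag k

theorem mem_expo {n e : ℕ} {α : Fin n →₀ ℕ} : α ∈ expo n e ↔ α.degree ≤ e := by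
  simp [expo, Finset.mem_finsuppAntidiag, Finsupp.degree_eq_sum]

/-- The exponents `α ∈ ℕⁿ` with `0 < |α| ≤ e`. -/
def posExpo (n e : ℕ) : Finset (Fin n →₀ ℕ) :=
  (expo n e).filter fun α => 0 < α.degree

/-- The number `s(e) = binom(n + e, e)` of monomials of degree at most `e` in `n` variables. -/
def numMon (n e : ℕ) : ℕ := (n + e).choose e

/-- An arrangement of the vector `[x]_e` of all monomials of degree at most `e`, of length
`s(e) = m l`: the monomial in row `a` of block `k` (position `k m + a` of the vector, counted
from `0`) is `x ^ ord (k, a)`. -/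
abbrev MonOrder (n e l m : ℕ) := Fin l × Fin m ≃ expo n e

namespace MonOrder

variable {n e l m : ℕ}

/-- The monomial vector `[x]_e`, as a one-column matrix. -/
def monVec (ord : MonOrder n e l m) :
    Matrix (Fin l × Fin m) (Fin 1) (MvPolynomial (Fin n) ℝ) :=
  Matrix.of fun x _ => MvPolynomial.monomial (ord x : Fin n →₀ ℕ) (1 : ℝ)

/-- The monomial tensor `fold_l [x]_e`. -/
def monTensor (ord : MonOrder n e l m) : Tensor m 1 l (MvPolynomial (Fin n) ℝ) :=
  Tensor.fold ord.monVec

/-- `l`-block circulant SOS polynomials of degree at most `2e`: the sums over finitely many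
generators `v` of the squares of `cᵀ [x]_e`, where `c` runs over the `l` columns of
`bcirc (fold_l v)`. -/
def IsBlockCirculantSOS (ord : MonOrder n e l m) (q : MvPolynomial (Fin n) ℝ) : Prop :=
  ∃ (t : ℕ) (gen : Fin t → Matrix (Fin l × Fin m) (Fin 1) ℝ),
    q = ∑ i, ∑ j : Fin l,
      (∑ x, MvPolynomial.C (Tensor.bcirc (Tensor.fold (gen i)) x (j, 0)) * ord.monVec x 0) ^ 2

end MonOrder

/-! ### Polynomial optimization problems and their relaxations -/

/-- The data of the problem: minimize `f x` subject to `g i x ≥ 0` for all `i`. -/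
structure POP (n r : ℕ) where
  f : MvPolynomial (Fin n) ℝ
  g : Fin r → MvPolynomial (Fin n) ℝ

namespace POP

variable {n r : ℕ} (P : POP n r) (l : Fin (r + 1) → ℕ)

/-- The feasible set. -/
def K : Set (Fin n → ℝ) := {x | ∀ i, 0 ≤ MvPolynomial.eval x (P.g i)}

/-- The constraint polynomials `g_1, …, g_r`, preceded by `g_0 = 1`. -/
def mult : Fin (r + 1) → MvPolynomial (Fin n) ℝ := Fin.cons 1 P.g

/-- `⌈w_i / 2⌉`, where `w_i` is the degree of `g_i`; it is `0` for `g_0 = 1`. -/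
def halfDeg (i : Fin (r + 1)) : ℕ := ((P.mult i).totalDegree + 1) / 2

/-- `N` is a relaxation level for the block numbers `l_0, …, l_r`: it is positive,
`2N ≥ deg f`, `2N ≥ deg g_i`, and `s(N - ⌈w_i / 2⌉)` is a multiple of `l_i`. -/
def IsLevel (N : ℕ) : Prop :=
  0 < N ∧ P.f.totalDegree ≤ 2 * N ∧ (∀ i, (P.g i).totalDegree ≤ 2 * N) ∧
    ∀ i, l i ∣ numMon n (N - P.halfDeg i)

/-- The relaxation levels for the block numbers `l_0, …, l_r`. -/
abbrev Level := {N : ℕ // P.IsLevel l N}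

/-- The block size `m_i`, with `m_i l_i = s(N - ⌈w_i / 2⌉)`. -/
def rows (N : ℕ) (i : Fin (r + 1)) : ℕ := numMon n (N - P.halfDeg i) / l i

/-- A choice of the monomial vectors `[x]_{N - ⌈w_i / 2⌉}` for all levels `N` and all `i`. -/
abbrev Arrangement :=
  ∀ (N : P.Level l) (i : Fin (r + 1)), MonOrder n (N - P.halfDeg i) (l i) (P.rows l N i)

variable {P l}

/-- The monomial tensors of every level are subtensors of those of all higher levels. -/
def Arrangement.Nested (ord : P.Arrangement l) : Prop :=
  ∀ N N' : P.Level l, N ≤ N' → ∀ i,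
    Tensor.IsSubtensor (ord N i).monTensor (ord N' i).monTensor

/-- `h = q_0 + ∑ g_i q_i` as polynomials, with `q_i` an `l_i`-block circulant SOS polynomial of
degree at most `2 (N - ⌈w_i / 2⌉)` for `i = 0, …, r`. -/
def HasCertificate (ord : P.Arrangement l) (N : P.Level l) (h : MvPolynomial (Fin n) ℝ) : Prop :=
  ∃ q : Fin (r + 1) → MvPolynomial (Fin n) ℝ,
    (∀ i, (ord N i).IsBlockCirculantSOS (q i)) ∧ h = ∑ i, P.mult i * q i

/-- The feasible set is compact, and for every `ε > 0` the polynomial `f - p + ε` has a block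
circulant certificate of some level. -/
def PutinarAssumption (ord : P.Arrangement l) (p : ℝ) : Prop :=
  IsCompact P.K ∧ ∀ ε : ℝ, 0 < ε → ∃ N : P.Level l,
    HasCertificate ord N (P.f - MvPolynomial.C p + MvPolynomial.C ε)

variable [∀ i, NeZero (l i)]

/-- The coefficient tensor of `x ^ α` in `g_i X_i * X_iᵀ`, where `X_i` is the monomial tensor. -/
def coeffTensor (ord : P.Arrangement l) (N : P.Level l) (i : Fin (r + 1)) (α : Fin n →₀ ℕ) :
    Tensor (P.rows l N i) (P.rows l N i) (l i) ℝ :=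
  fun k => Matrix.of fun a b => MvPolynomial.coeff α
    (P.mult i * Tensor.tprod (ord N i).monTensor (Tensor.transpose (ord N i).monTensor) k a b)

/-- The variables `Z_0, …, Z_r` of the relaxation. -/
abbrev PrimalVar (P : POP n r) (l : Fin (r + 1) → ℕ) (N : P.Level l) :=
  ∀ i : Fin (r + 1), Tensor (P.rows l N i) (P.rows l N i) (l i) ℝ

/-- Feasibility for the relaxation of level `N`. -/
def PrimalFeasible (ord : P.Arrangement l) (N : P.Level l) (Z : PrimalVar P l N) : Prop :=
  (∀ α ∈ posExpo n (2 * N),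
    ∑ i, Tensor.inner (Z i) (coeffTensor ord N i α) = MvPolynomial.coeff α P.f) ∧
  ∀ i, (Z i).IsPSD

/-- The objective function of the relaxation of level `N`, to be maximized. -/
def primalObj (ord : P.Arrangement l) (N : P.Level l) (Z : PrimalVar P l N) : ℝ :=
  -∑ i, Tensor.inner (Z i) (coeffTensor ord N i 0)

/-- The variables `y_α`, `0 < |α| ≤ 2N`, of the dual relaxation. -/
abbrev DualVar (n N : ℕ) := posExpo n (2 * N) → ℝ

/-- Feasibility for the dual of the relaxation of level `N`. -/
def DualFeasible (ord : P.Arrangement l) (N : P.Level l) (y : DualVar n N) : Prop :=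
  ∀ i, Tensor.IsPSD (coeffTensor ord N i 0 + ∑ α : posExpo n (2 * N), y α • coeffTensor ord N i α)

/-- The objective function of the dual of the relaxation of level `N`, to be minimized. -/
def dualObj (P : POP n r) (N : ℕ) (y : DualVar n N) : ℝ :=
  ∑ α : posExpo n (2 * N), MvPolynomial.coeff (α : Fin n →₀ ℕ) P.f * y α

/-- The values of the relaxation of level `N` at its feasible points. -/
def primalValues (ord : P.Arrangement l) (N : P.Level l) : Set ℝ :=
  primalObj ord N '' {Z | PrimalFeasible ord N Z}

/-- The values of the dual of the relaxation of level `N` at its feasible points. -/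
def dualValues (ord : P.Arrangement l) (N : P.Level l) : Set ℝ :=
  dualObj P N '' {y | DualFeasible ord N y}

/-- The optimal value of the relaxation of level `N` (`⊥` if it is infeasible). -/
def primalSup (ord : P.Arrangement l) (N : P.Level l) : EReal :=
  sSup ((fun v : ℝ => (v : EReal)) '' primalValues ord N)

/-- The optimal value of the dual of the relaxation of level `N` (`⊥` if it is unbounded). -/
def dualInf (ord : P.Arrangement l) (N : P.Level l) : EReal :=
  sInf ((fun v : ℝ => (v : EReal)) '' dualValues ord N)

end POP

/-- The vector of all moments `x ^ α`, `0 < |α| ≤ 2N`, of a point `x`. -/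
def momentVector {n : ℕ} (N : ℕ) (x : Fin n → ℝ) : POP.DualVar n N :=
  fun α => ∏ i, x i ^ (α : Fin n →₀ ℕ) i

end

noncomputable section

namespace Tensor

variable {m p q l : ℕ} {R : Type*}

theorem tprod_apply [CommSemiring R] (A : Tensor m p l R) (B : Tensor p q l R)
    (k : Fin l) (a : Fin m) (b : Fin q) :
    tprod A B k a b = ∑ x : Fin l × Fin p, A (k - x.1) a x.2 * B x.1 x.2 b := by
  simp [tprod, fold, bcirc, unfold, Matrix.mul_apply]

theorem inner_tprod (A : Tensor m m l ℝ) (X : Tensor m 1 l ℝ) :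
    inner X (tprod A X) = ∑ x : Fin l × Fin m, ∑ y : Fin l × Fin m,
      A (x.1 - y.1) x.2 y.2 * (X x.1 x.2 0 * X y.1 y.2 0) := by
  rw [Fintype.sum_prod_type]
  simp only [inner, tprod_apply, Finset.univ_unique, Finset.sum_singleton, Finset.mul_sum]
  refine Finset.sum_congr rfl fun i _ => Finset.sum_congr rfl fun a _ =>
    Finset.sum_congr rfl fun y _ => ?_
  simp only [Fin.default_eq_zero]
  ring

theorem inner_comm (A B : Tensor m p l ℝ) : inner A B = inner B A := by
  simp only [inner, mul_comm]

/-- The tensor `U * Uᵀ` of a one-column tensor `U`. -/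
def gram [NeZero l] [CommSemiring R] (U : Tensor m 1 l R) : Tensor m m l R :=
  tprod U U.transpose

variable [NeZero l]

theorem gram_sub_apply [CommSemiring R] (U : Tensor m 1 l R) (x y : Fin l × Fin m) :
    gram U (x.1 - y.1) x.2 y.2 = ∑ j, U (x.1 - j) x.2 0 * U (y.1 - j) y.2 0 := by
  rw [gram, tprod_apply, Fintype.sum_prod_type]
  simp only [Finset.univ_unique, Finset.sum_singleton, transpose, Matrix.transpose_apply]
  refine Fintype.sum_equiv (Equiv.subRight (-y.1)) _ _ fun j => ?_
  simp [sub_sub, add_comm]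

theorem gram_apply [CommSemiring R] (U : Tensor m 1 l R) (k : Fin l) (a b : Fin m) :
    gram U k a b = ∑ j, U (k - j) a 0 * U (-j) b 0 := by
  simpa using gram_sub_apply U (k, a) (0, b)

theorem bcirc_gram [CommSemiring R] (U : Tensor m 1 l R) :
    bcirc (gram U) = (Matrix.of fun x j => U (x.1 - j) x.2 0) *
      (Matrix.of fun (x : Fin l × Fin m) j => U (x.1 - j) x.2 0).transpose := by
  ext x y
  simp [bcirc, Matrix.mul_apply, gram_sub_apply]

/-- The entrywise pairing of `Z` with `U * Uᵀ` is the quadratic form of `bcirc Z` at `U`. -/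
theorem sum_mul_gram [CommSemiring R] (Z : Tensor m m l R) (U : Tensor m 1 l R) :
    ∑ k, ∑ a, ∑ b, Z k a b * gram U k a b =
      ∑ x : Fin l × Fin m, ∑ y : Fin l × Fin m,
        Z (x.1 - y.1) x.2 y.2 * (U x.1 x.2 0 * U y.1 y.2 0) := by
  have h1 : ∑ x : Fin l × Fin m, ∑ y : Fin l × Fin m,
        Z (x.1 - y.1) x.2 y.2 * (U x.1 x.2 0 * U y.1 y.2 0) =
      ∑ a, ∑ b, ∑ j, ∑ k, Z k a b * (U (k - j) a 0 * U (-j) b 0) := by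
    simp only [Fintype.sum_prod_type]
    rw [Finset.sum_comm]
    refine Finset.sum_congr rfl fun a _ => ?_
    rw [Finset.sum_congr rfl fun i _ => Finset.sum_comm, Finset.sum_comm]
    refine Finset.sum_congr rfl fun b _ => ?_
    rw [Finset.sum_comm]
    refine Fintype.sum_equiv (Equiv.neg _) _ _ fun j => ?_
    refine Fintype.sum_equiv (Equiv.subRight j) _ _ fun k => ?_
    simp
  rw [h1, Finset.sum_comm]
  refine Finset.sum_congr rfl fun a _ => ?_
  rw [Finset.sum_comm]
  refine Finset.sum_congr rfl fun b _ => ?_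
  rw [Finset.sum_comm]
  refine Finset.sum_congr rfl fun k _ => ?_
  rw [gram_apply, Finset.mul_sum]

theorem inner_gram (Z : Tensor m m l ℝ) (U : Tensor m 1 l ℝ) :
    inner Z (gram U) = inner U (tprod Z U) := by
  rw [inner_tprod, ← sum_mul_gram, inner]

theorem transpose_eq_iff (A : Tensor m m l ℝ) :
    A.transpose = A ↔ (bcirc A).IsHermitian := by
  constructor
  · intro h
    ext x y
    have := congrFun (congrFun (congrFun h (x.1 - y.1)) x.2) y.2
    simpa [transpose, bcirc] using this
  · intro h
    ext k a b
    simpa [transpose, bcirc] using congrFun (congrFun h (k, a)) (0, b)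

theorem isPSD_iff_posSemidef (A : Tensor m m l ℝ) :
    A.IsPSD ↔ (bcirc A).PosSemidef := by
  have hq (v : Fin l × Fin m → ℝ) : star v ⬝ᵥ (bcirc A).mulVec v =
      inner (fun k => Matrix.of fun a _ => v (k, a))
        (tprod A fun k => Matrix.of fun a (_ : Fin 1) => v (k, a)) := by
    rw [inner_tprod]
    simp only [dotProduct, Matrix.mulVec, bcirc, Matrix.of_apply, Finset.mul_sum, star_trivial]
    refine Finset.sum_congr rfl fun x _ => Finset.sum_congr rfl fun y _ => ?_
    ring
  rw [Matrix.posSemidef_iff_dotProduct_mulVec, IsPSD, transpose_eq_iff]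
  refine and_congr_right fun _ => ⟨fun h v => ?_, fun h X => ?_⟩
  · rw [hq]
    exact h _
  · have hX : X = fun k => Matrix.of fun a _ => X k a 0 := by
      ext k a b
      rw [Subsingleton.elim b 0]
      rfl
    rw [hX, ← hq fun x => X x.1 x.2 0]
    exact h _

theorem isPSD_gram (U : Tensor m 1 l ℝ) : (gram U).IsPSD := by
  rw [isPSD_iff_posSemidef, bcirc_gram]
  exact Matrix.posSemidef_self_mul_conjTranspose _

theorem IsPSD.add {A B : Tensor m m l ℝ} (hA : A.IsPSD) (hB : B.IsPSD) : (A + B).IsPSD := by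
  rw [isPSD_iff_posSemidef] at *
  exact hA.add hB

theorem IsPSD.smul {A : Tensor m m l ℝ} (hA : A.IsPSD) {c : ℝ} (hc : 0 ≤ c) :
    (c • A).IsPSD := by
  rw [isPSD_iff_posSemidef] at *
  exact hA.smul hc

theorem IsPSD.zero : (0 : Tensor m m l ℝ).IsPSD := by
  rw [isPSD_iff_posSemidef]
  exact Matrix.PosSemidef.zero

theorem IsPSD.sum {ι : Type*} (s : Finset ι) {A : ι → Tensor m m l ℝ}
    (hA : ∀ i ∈ s, (A i).IsPSD) : (∑ i ∈ s, A i).IsPSD :=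
  Finset.sum_induction _ _ (fun _ _ => IsPSD.add) IsPSD.zero hA

theorem IsPSD.submatrix {m' : ℕ} {A : Tensor m m l ℝ} (hA : A.IsPSD) (σ : Fin m' → Fin m) :
    IsPSD fun k => (A k).submatrix σ σ := by
  rw [isPSD_iff_posSemidef] at *
  exact hA.submatrix (Prod.map id σ)

theorem inner_nonneg_of_isPSD {A B : Tensor m m l ℝ} (hA : A.IsPSD) (hB : B.IsPSD) :
    0 ≤ inner A B := by
  rw [isPSD_iff_posSemidef] at hA hB
  have hl : (l : ℝ) * inner A B = ((bcirc A) * (bcirc B)).trace := by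
    have hs (x y) : bcirc B y x = bcirc B x y := by simpa using (hB.1.apply x y)
    simp only [Matrix.trace, Matrix.diag_apply, Matrix.mul_apply, hs]
    rw [Finset.sum_comm]
    simp only [Fintype.sum_prod_type, bcirc, Matrix.of_apply]
    have (j : Fin l) : ∑ b, ∑ i, ∑ a, A (i - j) a b * B (i - j) a b = inner A B := by
      rw [Finset.sum_comm, inner]
      refine Fintype.sum_equiv (Equiv.subRight j) _ _ fun i => ?_
      rw [Finset.sum_comm]
      rfl
    simp [this]
  obtain ⟨k, v, hv⟩ := Matrix.posSemidef_iff_eq_sum_vecMulVec.mp hA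
  have ht : 0 ≤ ((bcirc A) * (bcirc B)).trace := by
    rw [hv, Finset.sum_mul, Matrix.trace_sum]
    refine Finset.sum_nonneg fun i _ => ?_
    rw [Matrix.vecMulVec_mul, Matrix.trace_vecMulVec, dotProduct_comm, ← Matrix.dotProduct_mulVec]
    exact (Matrix.posSemidef_iff_dotProduct_mulVec.mp hB).2 _
  rw [← hl] at ht
  exact nonneg_of_mul_nonneg_right ht (by exact_mod_cast Nat.pos_of_neZero l)

theorem isClosed_setOf_isPSD : IsClosed {A : Tensor m m l ℝ | A.IsPSD} := by
  have h : {A : Tensor m m l ℝ | A.IsPSD} = {A | A.transpose = A} ∩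
      ⋂ X : Tensor m 1 l ℝ, {A | 0 ≤ inner X (tprod A X)} := by
    ext A; simp [IsPSD]
  rw [h]
  refine (isClosed_eq ?_ continuous_id).inter (isClosed_iInter fun X => isClosed_le
    continuous_const ?_)
  · unfold transpose
    fun_prop
  · simp only [inner_tprod]
    fun_prop

end Tensor


/-! ### Pairings of real tensors with Gram tensors of polynomials -/

namespace Tensor

variable {m n l : ℕ}

/-- Extension of a tensor by zero along a selection of rows and columns. -/
def extend {m' : ℕ} (σ : Fin m → Fin m') (Z : Tensor m m l ℝ) : Tensor m' m' l ℝ :=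
  fun k => Matrix.of fun a' b' => ∑ a, ∑ b, if σ a = a' ∧ σ b = b' then Z k a b else 0

theorem sum_extend_smul {m' : ℕ} {M : Type*} [AddCommGroup M] [Module ℝ M]
    (σ : Fin m → Fin m') (Z : Tensor m m l ℝ) (g : Fin l → Fin m' → Fin m' → M) :
    ∑ k, ∑ a', ∑ b', extend σ Z k a' b' • g k a' b' =
      ∑ k, ∑ a, ∑ b, Z k a b • g k (σ a) (σ b) := by
  refine Finset.sum_congr rfl fun k _ => ?_
  simp only [extend, Matrix.of_apply, Finset.sum_smul, ite_smul, zero_smul, ite_and]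
  simp only [Finset.sum_comm (s := (Finset.univ : Finset (Fin m')))
    (t := (Finset.univ : Finset (Fin m)))]
  simp

variable [NeZero l]

theorem gram_comm {R : Type*} [CommSemiring R] (U : Tensor m 1 l R) (k : Fin l) (a b : Fin m) :
    gram U (-k) b a = gram U k a b := by
  have h1 := gram_sub_apply U (0, b) (k, a)
  have h2 := gram_sub_apply U (k, a) (0, b)
  simp only [zero_sub, sub_zero] at h1 h2
  rw [h1, h2]
  exact Finset.sum_congr rfl fun j _ => mul_comm _ _

theorem map_gram {R S : Type*} [CommSemiring R] [CommSemiring S] (φ : R →+* S)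
    (U : Tensor m 1 l R) (k : Fin l) (a b : Fin m) :
    φ (gram U k a b) = gram (fun k => (U k).map φ) k a b := by
  simp [gram_apply]

theorem gram_of_eq_submatrix {m' : ℕ} {R : Type*} [CommSemiring R] {U : Tensor m 1 l R}
    {V : Tensor m' 1 l R} {σ : Fin m → Fin m'} (h : ∀ k a, U k a 0 = V k (σ a) 0)
    (k : Fin l) (a b : Fin m) : gram U k a b = gram V k (σ a) (σ b) := by
  simp [gram_apply, h]

/-- The polynomial `⟨Z, X * Xᵀ⟩`, as a linear function of `Z`. -/
def gramPoly (X : Tensor m 1 l (MvPolynomial (Fin n) ℝ)) :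
    Tensor m m l ℝ →ₗ[ℝ] MvPolynomial (Fin n) ℝ where
  toFun Z := ∑ k, ∑ a, ∑ b, Z k a b • gram X k a b
  map_add' Z W := by simp [add_smul, Finset.sum_add_distrib]
  map_smul' c Z := by simp [Finset.smul_sum, mul_smul]

theorem gramPoly_apply (X : Tensor m 1 l (MvPolynomial (Fin n) ℝ)) (Z : Tensor m m l ℝ) :
    gramPoly X Z = ∑ k, ∑ a, ∑ b, Z k a b • gram X k a b := rfl

theorem eval_gramPoly (X : Tensor m 1 l (MvPolynomial (Fin n) ℝ)) (Z : Tensor m m l ℝ)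
    (x : Fin n → ℝ) : MvPolynomial.eval x (gramPoly X Z) =
      inner Z (gram fun k => (X k).map (MvPolynomial.eval x)) := by
  simp [gramPoly_apply, inner, map_gram, MvPolynomial.smul_eval]

theorem gramPoly_gram (X : Tensor m 1 l (MvPolynomial (Fin n) ℝ)) (V : Tensor m 1 l ℝ) :
    gramPoly X (gram V) = ∑ j : Fin l,
      (∑ x : Fin l × Fin m, MvPolynomial.C (V (x.1 - j) x.2 0) * X x.1 x.2 0) ^ 2 := by
  have h := sum_mul_gram (fun k => (gram V k).map (MvPolynomial.C (σ := Fin n))) X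
  simp only [Matrix.map_apply, MvPolynomial.C_mul'] at h
  rw [gramPoly_apply, h]
  have (x y : Fin l × Fin m) : gram V (x.1 - y.1) x.2 y.2 • (X x.1 x.2 0 * X y.1 y.2 0) =
      ∑ j, (MvPolynomial.C (V (x.1 - j) x.2 0) * X x.1 x.2 0) *
        (MvPolynomial.C (V (y.1 - j) y.2 0) * X y.1 y.2 0) := by
    rw [gram_sub_apply, Finset.sum_smul]
    refine Finset.sum_congr rfl fun j _ => ?_
    rw [← MvPolynomial.C_mul', MvPolynomial.C_mul]
    ring
  simp only [this, sq, Finset.sum_mul_sum]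
  rw [Finset.sum_comm]
  exact (Finset.sum_congr rfl fun _ _ => Finset.sum_comm).trans
    (Finset.sum_comm.trans ((Finset.sum_congr rfl fun _ _ => Finset.sum_comm)))

theorem IsPSD.extend {m' : ℕ} {Z : Tensor m m l ℝ} (hZ : Z.IsPSD) (σ : Fin m → Fin m') :
    (Tensor.extend σ Z).IsPSD := by
  refine ⟨?_, fun X => ?_⟩
  · ext k a b
    have h (a b) : Z (-k) b a = Z k a b :=
      congrFun (congrFun (congrFun hZ.1 k) a) b
    simp only [Tensor.transpose, Matrix.transpose_apply, Tensor.extend, Matrix.of_apply]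
    rw [Finset.sum_comm]
    simp only [h, and_comm]
  · rw [← inner_gram]
    have h := sum_extend_smul σ Z fun k a b => gram X k a b
    simp only [smul_eq_mul] at h
    rw [inner, h]
    exact inner_nonneg_of_isPSD hZ ((isPSD_gram X).submatrix σ)

theorem gramPoly_extend {m' : ℕ} {X : Tensor m 1 l (MvPolynomial (Fin n) ℝ)}
    {Y : Tensor m' 1 l (MvPolynomial (Fin n) ℝ)} {σ : Fin m → Fin m'}
    (h : ∀ k a, X k a 0 = Y k (σ a) 0) (Z : Tensor m m l ℝ) :
    gramPoly Y (extend σ Z) = gramPoly X Z := by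
  simp only [gramPoly_apply, gram_of_eq_submatrix h]
  exact sum_extend_smul σ Z fun k a b => gram Y k a b

end Tensor

/-! ### Polynomials vanishing on a set with interior points -/

theorem MvPolynomial.eq_zero_of_eval_zero_of_mem_nhds {n : ℕ} {p : MvPolynomial (Fin n) ℝ}
    {s : Set (Fin n → ℝ)} {x₀ : Fin n → ℝ} (hs : s ∈ 𝓝 x₀)
    (h : ∀ x ∈ s, MvPolynomial.eval x p = 0) : p = 0 := by
  obtain ⟨ε, hε, hb⟩ := Metric.mem_nhds_iff.mp hs
  refine MvPolynomial.funext_set (fun i => Metric.ball (x₀ i) ε) (fun i => ?_) fun x hx => ?_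
  · rw [Real.ball_eq_Ioo]
    exact Set.Ioo_infinite (by linarith)
  · rw [map_zero]
    refine h x (hb ?_)
    rwa [ball_pi _ hε]

/-! ### Closedness of linear images of cones and separation -/

theorem isClosed_image_cone_of_normed {E F : Type*} [NormedAddCommGroup E] [NormedSpace ℝ E]
    [FiniteDimensional ℝ E] [NormedAddCommGroup F] [NormedSpace ℝ F] {S : Set E}
    (hS : IsClosed S) (hcone : ∀ x ∈ S, ∀ c : ℝ, 0 ≤ c → c • x ∈ S) (T : E →ₗ[ℝ] F)
    (hT : ∀ x ∈ S, T x = 0 → x = 0) : IsClosed (T '' S) := by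
  have : ProperSpace E := FiniteDimensional.proper ℝ E
  have hTc : Continuous T := T.continuous_of_finiteDimensional
  obtain ⟨c, hc, hbound⟩ : ∃ c : ℝ, 0 < c ∧ ∀ x ∈ S, c * ‖x‖ ≤ ‖T x‖ := by
    have hcomp : IsCompact (S ∩ Metric.sphere 0 1) := (isCompact_sphere 0 1).inter_left hS
    have hmem : ∀ x ∈ S, x ≠ 0 → ‖x‖⁻¹ • x ∈ S ∩ Metric.sphere 0 1 := fun x hx h0 =>
      ⟨hcone x hx _ (by positivity), by
        rw [mem_sphere_zero_iff_norm, norm_smul, norm_inv, norm_norm,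
          inv_mul_cancel₀ (norm_ne_zero_iff.mpr h0)]⟩
    by_cases hne : (S ∩ Metric.sphere (0 : E) 1).Nonempty
    · obtain ⟨z, hz, hmin⟩ := hcomp.exists_isMinOn hne (hTc.norm.continuousOn)
      refine ⟨‖T z‖, norm_pos_iff.mpr fun h => ?_, fun x hx => ?_⟩
      · have := hz.2
        rw [hT z hz.1 h] at this
        simp at this
      · by_cases h0 : x = 0
        · simp [h0]
        · have h := isMinOn_iff.mp hmin _ (hmem x hx h0)
          simp only [map_smul, norm_smul, norm_inv, norm_norm] at h
          have hp : 0 < ‖x‖ := norm_pos_iff.mpr h0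
          calc ‖T z‖ * ‖x‖ ≤ ‖x‖⁻¹ * ‖T x‖ * ‖x‖ := by gcongr
            _ = ‖T x‖ := by field_simp
    · refine ⟨1, one_pos, fun x hx => ?_⟩
      have h0 : x = 0 := by
        by_contra h0
        exact hne ⟨_, hmem x hx h0⟩
      simp [h0]
  refine IsSeqClosed.isClosed fun u y hu hy => ?_
  choose z hzS hz using hu
  obtain ⟨R, hR⟩ := (Metric.isBounded_range_of_tendsto u hy).exists_norm_le
  have hzb : Bornology.IsBounded (Set.range z) := by
    refine isBounded_iff_forall_norm_le.mpr ⟨R / c, ?_⟩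
    rintro _ ⟨k, rfl⟩
    rw [le_div_iff₀ hc, mul_comm]
    refine (hbound _ (hzS k)).trans ?_
    rw [hz]
    exact hR _ ⟨k, rfl⟩
  obtain ⟨w, -, φ, hφ, hw⟩ := tendsto_subseq_of_bounded hzb fun k => Set.mem_range_self k
  refine ⟨w, hS.mem_of_tendsto hw (Eventually.of_forall fun k => hzS _), ?_⟩
  refine tendsto_nhds_unique ((hTc.tendsto w).comp hw) ?_
  refine (hy.comp hφ.tendsto_atTop).congr fun k => ?_
  simp [hz]

/-- The image of a closed cone in a finite-dimensional space under a linear map whose kernel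
meets the cone only in `0` is closed. -/
theorem isClosed_image_cone {E F : Type*} [AddCommGroup E] [Module ℝ E] [TopologicalSpace E]
    [IsTopologicalAddGroup E] [ContinuousSMul ℝ E] [T2Space E]
    [FiniteDimensional ℝ E] [NormedAddCommGroup F] [NormedSpace ℝ F] {S : Set E}
    (hS : IsClosed S) (hcone : ∀ x ∈ S, ∀ c : ℝ, 0 ≤ c → c • x ∈ S) (T : E →ₗ[ℝ] F)
    (hT : ∀ x ∈ S, T x = 0 → x = 0) : IsClosed (T '' S) := by
  have h := isClosed_image_cone_of_normed (S := toEuclidean '' S)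
    (T := T ∘ₗ (toEuclidean (E := E)).symm.toLinearMap)
    ((toEuclidean (E := E)).toHomeomorph.isClosedMap _ hS) ?_ ?_
  · rw [← Set.image_comp] at h
    have hcomp : (T ∘ₗ (toEuclidean (E := E)).symm.toLinearMap) ∘ toEuclidean = T :=
      funext fun x => by simp
    rwa [hcomp] at h
  · rintro _ ⟨x, hx, rfl⟩ c hc
    exact ⟨c • x, hcone x hx c hc, by simp⟩
  · rintro _ ⟨x, hx, rfl⟩ h
    rw [hT x hx (by simpa using h), map_zero]

theorem exists_separating_functional_of_cone {F : Type*} [NormedAddCommGroup F]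
    [NormedSpace ℝ F] {S : Set F} (hS : IsClosed S) (hconv : Convex ℝ S) (h0 : 0 ∈ S)
    (hcone : ∀ x ∈ S, ∀ c : ℝ, 0 ≤ c → c • x ∈ S) {x : F} (hx : x ∉ S) :
    ∃ φ : F →ₗ[ℝ] ℝ, (∀ b ∈ S, 0 ≤ φ b) ∧ φ x < 0 := by
  obtain ⟨φ, u, hxu, hu⟩ := geometric_hahn_banach_point_closed hconv hS hx
  have hu0 : u < 0 := by simpa using hu 0 h0
  refine ⟨φ.toLinearMap, fun b hb => ?_, hxu.trans hu0⟩
  by_contra! hneg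
  have hb0 : φ b < 0 := hneg
  have h := hu _ (hcone b hb (u / φ b) (div_nonneg_of_nonpos hu0.le hb0.le))
  rw [map_smul, smul_eq_mul, div_mul_cancel₀ _ hb0.ne] at h
  exact lt_irrefl _ h


namespace MvPolynomial

variable {n e : ℕ}

theorem coeff_eq_zero_of_notMem_expo {h : MvPolynomial (Fin n) ℝ} (hd : h.totalDegree ≤ e)
    {α : Fin n →₀ ℕ} (hα : α ∉ expo n e) : coeff α h = 0 := by
  refine coeff_eq_zero_of_totalDegree_lt ?_
  rw [mem_expo, not_le] at hα
  exact hd.trans_lt hα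

theorem ext_of_expo {h h' : MvPolynomial (Fin n) ℝ} (hd : h.totalDegree ≤ e)
    (hd' : h'.totalDegree ≤ e) (hc : ∀ α ∈ expo n e, coeff α h = coeff α h') : h = h' := by
  ext α
  by_cases hα : α ∈ expo n e
  · exact hc α hα
  · rw [coeff_eq_zero_of_notMem_expo hd hα, coeff_eq_zero_of_notMem_expo hd' hα]

theorem zero_mem_expo : (0 : Fin n →₀ ℕ) ∈ expo n e := by simp [mem_expo]

theorem expo_eq_insert : expo n e = insert 0 (posExpo n e) := by
  ext α
  simp only [posExpo, Finset.mem_insert, Finset.mem_filter, pos_iff_ne_zero,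
    Ne, Finsupp.degree_eq_zero_iff]
  refine ⟨fun h => ?_, ?_⟩
  · by_cases h0 : α = 0 <;> simp [*]
  · rintro (rfl | h)
    · exact zero_mem_expo
    · exact h.1

theorem zero_notMem_posExpo : (0 : Fin n →₀ ℕ) ∉ posExpo n e := by simp [posExpo]

/-- A linear functional on polynomials of degree at most `e` in terms of its moments. -/
theorem linearMap_apply_eq_sum {h : MvPolynomial (Fin n) ℝ} (hd : h.totalDegree ≤ e)
    (L : MvPolynomial (Fin n) ℝ →ₗ[ℝ] ℝ) :
    L h = coeff 0 h * L 1 + ∑ α : posExpo n e, coeff (α : Fin n →₀ ℕ) h * L (monomial α 1) := by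
  have hsum : h = ∑ α ∈ expo n e, coeff α h • monomial α (1 : ℝ) := by
    refine (h.as_sum).trans ?_
    simp only [smul_monomial, smul_eq_mul, mul_one]
    refine Finset.sum_subset (fun α hα => ?_) fun α _ hα => ?_
    · by_contra hn
      exact mem_support_iff.mp hα (coeff_eq_zero_of_notMem_expo hd hn)
    · rw [notMem_support_iff.mp hα, monomial_zero]
  conv_lhs => rw [hsum]
  rw [expo_eq_insert, Finset.sum_insert zero_notMem_posExpo, map_add, map_sum]
  simp only [map_smul, smul_eq_mul]
  rw [← Finset.sum_coe_sort]
  rfl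

end MvPolynomial

namespace POP

open Tensor MvPolynomial

variable {n r : ℕ} {P : POP n r} {l : Fin (r + 1) → ℕ}

theorem mult_nonneg {x : Fin n → ℝ} (hx : x ∈ P.K) (i : Fin (r + 1)) :
    0 ≤ eval x (P.mult i) := by
  refine Fin.cases ?_ (fun j => ?_) i
  · simp [mult]
  · simpa [mult] using hx j

theorem mult_totalDegree_le (N : P.Level l) (i : Fin (r + 1)) :
    (P.mult i).totalDegree ≤ 2 * (N : ℕ) := by
  refine Fin.cases ?_ (fun j => ?_) i
  · simp [mult]
  · simpa [mult] using N.2.2.2.1 j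

variable {ord : P.Arrangement l}

/-- The moments `L (x ^ α)`, `0 < |α| ≤ 2N`, of a linear functional. -/
def moments (N : ℕ) (L : MvPolynomial (Fin n) ℝ →ₗ[ℝ] ℝ) : DualVar n N :=
  fun α => L (monomial α 1)

theorem exists_moments_eq (N : ℕ) (y : DualVar n N) :
    ∃ L : MvPolynomial (Fin n) ℝ →ₗ[ℝ] ℝ, L 1 = 1 ∧ moments N L = y := by
  let Y : (Fin n →₀ ℕ) → ℝ := fun α => if h : α ∈ posExpo n (2 * N) then y ⟨α, h⟩ else 1
  let L : MvPolynomial (Fin n) ℝ →ₗ[ℝ] ℝ := (basisMonomials (Fin n) ℝ).constr ℝ Y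
  have hL (α : Fin n →₀ ℕ) : L (monomial α 1) = Y α := by
    have := (basisMonomials (Fin n) ℝ).constr_basis ℝ Y α
    rwa [coe_basisMonomials] at this
  refine ⟨L, ?_, ?_⟩
  · have h1 := hL 0
    rw [show (monomial (0 : Fin n →₀ ℕ) (1 : ℝ)) = 1 from rfl] at h1
    rw [h1]
    simp [Y, zero_notMem_posExpo]
  · ext α
    simp [moments, hL, Y]

theorem dualObj_moments (hf0 : coeff 0 P.f = 0) (N : P.Level l)
    (L : MvPolynomial (Fin n) ℝ →ₗ[ℝ] ℝ) : dualObj P N (moments N L) = L P.f := by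
  rw [linearMap_apply_eq_sum N.2.2.1 L, hf0, zero_mul, zero_add]
  rfl

theorem Arrangement.Nested.exists_selection (h : ord.Nested) {N N' : P.Level l} (hN : N ≤ N')
    (i : Fin (r + 1)) : ∃ σ : Fin (P.rows l N i) → Fin (P.rows l N' i),
      ∀ k a, (ord N i).monTensor k a 0 = (ord N' i).monTensor k (σ a) 0 := by
  obtain ⟨σ, τ, hστ⟩ := h N N' hN i
  refine ⟨σ, fun k a => ?_⟩
  have := congrFun (congrFun (hστ k) a) 0
  rwa [Matrix.submatrix_apply, Subsingleton.elim (τ 0) 0] at this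

variable [∀ i, NeZero (l i)]

theorem totalDegree_mult_mul_gram_le (ord : P.Arrangement l) (N : P.Level l) (i : Fin (r + 1))
    (k : Fin (l i)) (a b) :
    (P.mult i * gram (ord N i).monTensor k a b).totalDegree ≤ 2 * (N : ℕ) := by
  have hX (k : Fin (l i)) (a) :
      ((ord N i).monTensor k a 0).totalDegree ≤ N - P.halfDeg i := by
    refine (totalDegree_monomial_le _ _).trans ?_
    exact mem_expo.mp ((ord N i) (k, a)).2
  have hG : (gram (ord N i).monTensor k a b).totalDegree ≤ 2 * (N - P.halfDeg i) := by
    rw [gram_apply]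
    refine totalDegree_finsetSum_le fun j _ => (totalDegree_mul _ _).trans ?_
    have h1 := hX (k - j) a
    have h2 := hX (-j) b
    lia
  have hd := mult_totalDegree_le N i
  refine (totalDegree_mul _ _).trans ?_
  have : P.halfDeg i = ((P.mult i).totalDegree + 1) / 2 := rfl
  lia

/-- The polynomial `∑ g_i ⟨Z_i, X_i * X_iᵀ⟩`, as a linear function of the variables `Z_i`. -/
def certPoly (ord : P.Arrangement l) (N : P.Level l) :
    PrimalVar P l N →ₗ[ℝ] MvPolynomial (Fin n) ℝ :=
  ∑ i, LinearMap.mulLeft ℝ (P.mult i) ∘ₗ gramPoly (ord N i).monTensor ∘ₗ LinearMap.proj i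

theorem certPoly_apply (N : P.Level l) (Z : PrimalVar P l N) :
    certPoly ord N Z = ∑ i, P.mult i * gramPoly (ord N i).monTensor (Z i) := by
  simp [certPoly]

theorem mult_mul_gramPoly (N : P.Level l) (i : Fin (r + 1))
    (Z : Tensor (P.rows l N i) (P.rows l N i) (l i) ℝ) :
    P.mult i * gramPoly (ord N i).monTensor Z =
      ∑ k, ∑ a, ∑ b, Z k a b • (P.mult i * gram (ord N i).monTensor k a b) := by
  simp only [gramPoly_apply, Finset.mul_sum, mul_smul_comm]

theorem totalDegree_certPoly_le (N : P.Level l) (Z : PrimalVar P l N) :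
    (certPoly ord N Z).totalDegree ≤ 2 * (N : ℕ) := by
  rw [certPoly_apply]
  refine totalDegree_finsetSum_le fun i _ => ?_
  rw [mult_mul_gramPoly]
  refine totalDegree_finsetSum_le fun k _ => totalDegree_finsetSum_le fun a _ =>
    totalDegree_finsetSum_le fun b _ => (totalDegree_smul_le _ _).trans ?_
  exact totalDegree_mult_mul_gram_le ord N i k a b

theorem inner_coeffTensor (N : P.Level l) (Z : PrimalVar P l N) (α : Fin n →₀ ℕ) :
    ∑ i, Tensor.inner (Z i) (coeffTensor ord N i α) = coeff α (certPoly ord N Z) := by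
  rw [certPoly_apply, coeff_sum]
  refine Finset.sum_congr rfl fun i _ => ?_
  rw [mult_mul_gramPoly]
  simp only [coeff_sum, coeff_smul]
  rfl

/-- The values of the relaxation are the numbers `v` for which `f - v` is a certificate. -/
theorem mem_primalValues_iff (hf0 : coeff 0 P.f = 0) {N : P.Level l} {v : ℝ} :
    v ∈ primalValues ord N ↔
      ∃ Z : PrimalVar P l N, (∀ i, (Z i).IsPSD) ∧ P.f - C v = certPoly ord N Z := by
  have hdeg (v : ℝ) : (P.f - C v).totalDegree ≤ 2 * (N : ℕ) :=
    (totalDegree_sub_C_le _ _).trans N.2.2.1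
  constructor
  · rintro ⟨Z, ⟨hZ, hpsd⟩, rfl⟩
    refine ⟨Z, hpsd, ext_of_expo (hdeg _) (totalDegree_certPoly_le N Z) fun α hα => ?_⟩
    rw [expo_eq_insert, Finset.mem_insert] at hα
    rcases hα with rfl | hα
    · simp [hf0, primalObj, inner_coeffTensor]
    · have h0 : (0 : Fin n →₀ ℕ) ≠ α := fun h => zero_notMem_posExpo (h ▸ hα)
      rw [← inner_coeffTensor, hZ α hα]
      simp [coeff_C, h0]
  · rintro ⟨Z, hpsd, hv⟩
    refine ⟨Z, ⟨fun α hα => ?_, hpsd⟩, ?_⟩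
    · have h0 : (0 : Fin n →₀ ℕ) ≠ α := fun h => zero_notMem_posExpo (h ▸ hα)
      rw [inner_coeffTensor, ← hv]
      simp [coeff_C, h0]
    · rw [primalObj, inner_coeffTensor, ← hv]
      simp [hf0]

/-- The localizing tensor of a linear functional on polynomials. -/
def localizing (ord : P.Arrangement l) (N : P.Level l) (L : MvPolynomial (Fin n) ℝ →ₗ[ℝ] ℝ)
    (i : Fin (r + 1)) : Tensor (P.rows l N i) (P.rows l N i) (l i) ℝ :=
  fun k => Matrix.of fun a b => L (P.mult i * gram (ord N i).monTensor k a b)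

theorem inner_localizing (N : P.Level l) (L : MvPolynomial (Fin n) ℝ →ₗ[ℝ] ℝ)
    (i : Fin (r + 1)) (Z : Tensor (P.rows l N i) (P.rows l N i) (l i) ℝ) :
    Tensor.inner Z (localizing ord N L i) = L (P.mult i * gramPoly (ord N i).monTensor Z) := by
  rw [mult_mul_gramPoly]
  simp [Tensor.inner, localizing]

theorem sum_inner_localizing (N : P.Level l) (L : MvPolynomial (Fin n) ℝ →ₗ[ℝ] ℝ)
    (Z : PrimalVar P l N) :
    ∑ i, Tensor.inner (Z i) (localizing ord N L i) = L (certPoly ord N Z) := by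
  simp only [inner_localizing, certPoly_apply, map_sum]

theorem dualFeasible_moments_iff {N : P.Level l} {L : MvPolynomial (Fin n) ℝ →ₗ[ℝ] ℝ}
    (hL : L 1 = 1) :
    DualFeasible ord N (moments N L) ↔ ∀ i, (localizing ord N L i).IsPSD := by
  refine forall_congr' fun i => ?_
  have : coeffTensor ord N i 0 +
      ∑ α : posExpo n (2 * (N : ℕ)), moments N L α • coeffTensor ord N i α =
        localizing ord N L i := by
    ext k a b
    have h := linearMap_apply_eq_sum (totalDegree_mult_mul_gram_le ord N i k a b) L
    rw [hL, mul_one] at h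
    simp only [localizing, Matrix.of_apply, h]
    simp only [Pi.add_apply, Finset.sum_apply, Pi.smul_apply, Matrix.add_apply, Matrix.sum_apply,
      Matrix.smul_apply, smul_eq_mul, mul_comm (moments N L _)]
    rfl
  rw [this]

theorem mem_dualValues_iff (hf0 : coeff 0 P.f = 0) {N : P.Level l} {v : ℝ} :
    v ∈ dualValues ord N ↔ ∃ L : MvPolynomial (Fin n) ℝ →ₗ[ℝ] ℝ,
      L 1 = 1 ∧ (∀ i, (localizing ord N L i).IsPSD) ∧ L P.f = v := by
  constructor
  · rintro ⟨y, hy, rfl⟩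
    obtain ⟨L, hL, rfl⟩ := exists_moments_eq (N : ℕ) y
    exact ⟨L, hL, (dualFeasible_moments_iff hL).mp hy, (dualObj_moments hf0 N L).symm⟩
  · rintro ⟨L, hL, hpsd, rfl⟩
    exact ⟨moments N L, (dualFeasible_moments_iff hL).mpr hpsd, dualObj_moments hf0 N L⟩

/-- Evaluation at a point, as a linear functional. -/
def evalₗ (x : Fin n → ℝ) : MvPolynomial (Fin n) ℝ →ₗ[ℝ] ℝ := (aeval x).toLinearMap

theorem evalₗ_apply (x : Fin n → ℝ) (h : MvPolynomial (Fin n) ℝ) : evalₗ x h = eval x h := by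
  simp [evalₗ, aeval_eq_eval]

theorem momentVector_eq (N : ℕ) (x : Fin n → ℝ) : momentVector N x = moments N (evalₗ x) := by
  ext α
  rw [moments, evalₗ_apply, eval_monomial, one_mul, Finsupp.prod_fintype _ _ (by simp)]
  rfl

theorem isPSD_localizing_evalₗ (N : P.Level l) {x : Fin n → ℝ} (hx : x ∈ P.K)
    (i : Fin (r + 1)) : (localizing ord N (evalₗ x) i).IsPSD := by
  have : localizing ord N (evalₗ x) i =
      eval x (P.mult i) • gram fun k => ((ord N i).monTensor k).map (eval x) := by
    ext k a b
    simp [localizing, evalₗ_apply, map_gram]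
  rw [this]
  exact (isPSD_gram _).smul (mult_nonneg hx i)

theorem eval_mem_dualValues (hf0 : coeff 0 P.f = 0) (N : P.Level l) {x : Fin n → ℝ}
    (hx : x ∈ P.K) : eval x P.f ∈ dualValues ord N :=
  (mem_dualValues_iff hf0).mpr
    ⟨evalₗ x, by simp [evalₗ_apply], isPSD_localizing_evalₗ N hx, evalₗ_apply x _⟩

theorem primal_le_dual (hf0 : coeff 0 P.f = 0) {N : P.Level l} {v w : ℝ}
    (hv : v ∈ primalValues ord N) (hw : w ∈ dualValues ord N) : v ≤ w := by
  obtain ⟨Z, hZ, hv⟩ := (mem_primalValues_iff hf0).mp hv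
  obtain ⟨L, hL, hpsd, rfl⟩ := (mem_dualValues_iff hf0).mp hw
  have h : 0 ≤ L (certPoly ord N Z) := by
    rw [← sum_inner_localizing]
    exact Finset.sum_nonneg fun i _ => inner_nonneg_of_isPSD (hZ i) (hpsd i)
  have hC : L (C v) = v := by
    rw [← mul_one (C v), C_mul', map_smul, hL, smul_eq_mul, mul_one]
  rw [← hv, map_sub, hC] at h
  linarith

theorem primalSup_le_dualInf (hf0 : coeff 0 P.f = 0) (N : P.Level l) :
    primalSup ord N ≤ dualInf ord N := by
  refine sSup_le ?_
  rintro _ ⟨v, hv, rfl⟩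
  refine le_sInf ?_
  rintro _ ⟨w, hw, rfl⟩
  exact EReal.coe_le_coe_iff.mpr (primal_le_dual hf0 hv hw)

theorem exists_isPSD_of_isBlockCirculantSOS {N : P.Level l} {i : Fin (r + 1)}
    {q : MvPolynomial (Fin n) ℝ} (hq : (ord N i).IsBlockCirculantSOS q) :
    ∃ Z : Tensor (P.rows l N i) (P.rows l N i) (l i) ℝ,
      Z.IsPSD ∧ gramPoly (ord N i).monTensor Z = q := by
  obtain ⟨t, v, rfl⟩ := hq
  refine ⟨∑ s, gram (fold (v s)), IsPSD.sum _ fun s _ => isPSD_gram _, ?_⟩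
  rw [map_sum]
  exact Finset.sum_congr rfl fun s _ => gramPoly_gram _ _

theorem mem_primalValues_of_hasCertificate (hf0 : coeff 0 P.f = 0) {N : P.Level l} {v : ℝ}
    (h : HasCertificate ord N (P.f - C v)) : v ∈ primalValues ord N := by
  obtain ⟨q, hq, hv⟩ := h
  choose Z hZ hZq using fun i => exists_isPSD_of_isBlockCirculantSOS (hq i)
  refine (mem_primalValues_iff hf0).mpr ⟨Z, hZ, ?_⟩
  rw [hv, certPoly_apply]
  exact Finset.sum_congr rfl fun i _ => by rw [hZq]

/-! ### Monotonicity for nested arrangements -/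

theorem primalValues_subset (hf0 : coeff 0 P.f = 0) (h : ord.Nested) {N N' : P.Level l}
    (hN : N ≤ N') : primalValues ord N ⊆ primalValues ord N' := by
  intro v hv
  obtain ⟨Z, hZ, hv⟩ := (mem_primalValues_iff hf0).mp hv
  choose σ hσ using h.exists_selection hN
  refine (mem_primalValues_iff hf0).mpr
    ⟨fun i => extend (σ i) (Z i), fun i => (hZ i).extend _, ?_⟩
  rw [hv, certPoly_apply, certPoly_apply]
  exact Finset.sum_congr rfl fun i _ => by rw [gramPoly_extend (hσ i)]

theorem dualValues_subset (hf0 : coeff 0 P.f = 0) (h : ord.Nested) {N N' : P.Level l}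
    (hN : N ≤ N') : dualValues ord N' ⊆ dualValues ord N := by
  intro v hv
  obtain ⟨L, hL, hpsd, rfl⟩ := (mem_dualValues_iff hf0).mp hv
  choose σ hσ using h.exists_selection hN
  refine (mem_dualValues_iff hf0).mpr ⟨L, hL, fun i => ?_, rfl⟩
  have : localizing ord N L i = fun k => (localizing ord N' L i k).submatrix (σ i) (σ i) := by
    ext k a b
    simp [localizing, gram_of_eq_submatrix (hσ i)]
  rw [this]
  exact (hpsd i).submatrix _

theorem monotone_primalSup (hf0 : coeff 0 P.f = 0) (h : ord.Nested) :
    Monotone (primalSup ord) :=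
  fun _ _ hN => sSup_le_sSup (Set.image_mono (primalValues_subset hf0 h hN))

theorem monotone_dualInf (hf0 : coeff 0 P.f = 0) (h : ord.Nested) :
    Monotone (dualInf ord) :=
  fun _ _ hN => sInf_le_sInf (Set.image_mono (dualValues_subset hf0 h hN))

/-! ### Absence of a duality gap -/

theorem eq_zero_of_gramPoly_eq_zero {N : P.Level l} {i : Fin (r + 1)}
    {Z : Tensor (P.rows l N i) (P.rows l N i) (l i) ℝ} (hZ : Z.IsPSD)
    (h : gramPoly (ord N i).monTensor Z = 0) : Z = 0 := by
  have hpsd := (isPSD_iff_posSemidef Z).mp hZ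
  let w (x : Fin n → ℝ) : Fin (l i) × Fin (P.rows l N i) → ℝ :=
    fun c => eval x ((ord N i).monTensor c.1 c.2 0)
  have hw (x : Fin n → ℝ) : (bcirc Z).mulVec (w x) = 0 := by
    rw [← hpsd.dotProduct_mulVec_zero_iff]
    have h0 := eval_gramPoly (ord N i).monTensor Z x
    rw [h, map_zero, inner_gram, inner_tprod] at h0
    rw [h0]
    simp only [dotProduct, Matrix.mulVec, bcirc, Matrix.of_apply, Finset.mul_sum, star_trivial]
    refine Finset.sum_congr rfl fun x _ => Finset.sum_congr rfl fun y _ => ?_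
    simp only [w, Matrix.map_apply]
    ring
  have hpoly (c : Fin (l i) × Fin (P.rows l N i)) :
      ∑ d, bcirc Z c d • monomial (ord N i d : Fin n →₀ ℕ) (1 : ℝ) = 0 := by
    refine MvPolynomial.funext fun x => ?_
    have := congrFun (hw x) c
    simpa [Matrix.mulVec, dotProduct, w, MonOrder.monTensor, MonOrder.monVec, fold, smul_eval]
      using this
  ext k a b
  have hc := congrArg (coeff (ord N i (0, b) : Fin n →₀ ℕ)) (hpoly (k, a))
  have hinj (d) : ((ord N i d : Fin n →₀ ℕ) = ord N i (0, b)) ↔ d = (0, b) := by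
    rw [← Subtype.ext_iff, EmbeddingLike.apply_eq_iff_eq]
  simpa [coeff_sum, coeff_monomial, hinj, bcirc] using hc

/-- The cone of feasible directions of the relaxation, without the blocks that belong to
vanishing constraint polynomials. -/
def psdCone (P : POP n r) (l : Fin (r + 1) → ℕ) [∀ i, NeZero (l i)] (N : P.Level l) :
    Set (PrimalVar P l N) :=
  {Z | ∀ i, (Z i).IsPSD ∧ (P.mult i = 0 → Z i = 0)}

theorem isClosed_psdCone (N : P.Level l) : IsClosed (psdCone P l N) := by
  have : psdCone P l N = ⋂ i, {Z | (Z i).IsPSD} ∩ ⋂ _ : P.mult i = 0, {Z | Z i = 0} := by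
    ext Z
    simp [psdCone]
  rw [this]
  refine isClosed_iInter fun i => IsClosed.inter ?_
    (isClosed_iInter fun _ => isClosed_eq (continuous_apply i) continuous_const)
  exact isClosed_setOf_isPSD.preimage
    (continuous_apply (A := fun i => Tensor (P.rows l N i) (P.rows l N i) (l i) ℝ) i)

theorem smul_mem_psdCone {N : P.Level l} {Z : PrimalVar P l N} (hZ : Z ∈ psdCone P l N) {c : ℝ}
    (hc : 0 ≤ c) : c • Z ∈ psdCone P l N :=
  fun i => ⟨(hZ i).1.smul hc, fun h => by rw [Pi.smul_apply, (hZ i).2 h, smul_zero]⟩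

theorem add_mem_psdCone {N : P.Level l} {Z W : PrimalVar P l N} (hZ : Z ∈ psdCone P l N)
    (hW : W ∈ psdCone P l N) : Z + W ∈ psdCone P l N :=
  fun i => ⟨(hZ i).1.add (hW i).1, fun h => by
    rw [Pi.add_apply, (hZ i).2 h, (hW i).2 h, add_zero]⟩

theorem eq_zero_of_certPoly_eq_zero (hK : (interior P.K).Nonempty) {N : P.Level l}
    {Z : PrimalVar P l N} (hZ : Z ∈ psdCone P l N) (h : certPoly ord N Z = 0) : Z = 0 := by
  obtain ⟨x₀, hx₀⟩ := hK
  funext i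
  have hprod : P.mult i * gramPoly (ord N i).monTensor (Z i) = 0 := by
    refine MvPolynomial.eq_zero_of_eval_zero_of_mem_nhds
      (mem_interior_iff_mem_nhds.mp hx₀) fun x hx => ?_
    have hx0 := congrArg (eval x) h
    rw [certPoly_apply, map_sum, map_zero] at hx0
    refine (Finset.sum_eq_zero_iff_of_nonneg fun j _ => ?_).mp hx0 i (Finset.mem_univ i)
    rw [map_mul, eval_gramPoly]
    exact mul_nonneg (mult_nonneg hx j) (inner_nonneg_of_isPSD (hZ j).1 (isPSD_gram _))
  rcases mul_eq_zero.mp hprod with h0 | h0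
  · exact (hZ i).2 h0
  · exact eq_zero_of_gramPoly_eq_zero (hZ i).1 h0

/-- The coefficients of the monomials of degree at most `e`. -/
def coeffVec (n e : ℕ) : MvPolynomial (Fin n) ℝ →ₗ[ℝ] (expo n e → ℝ) :=
  LinearMap.pi fun α => lcoeff ℝ (α : Fin n →₀ ℕ)

theorem isPSD_localizing_of_nonneg {N : P.Level l} {L : MvPolynomial (Fin n) ℝ →ₗ[ℝ] ℝ}
    (hL : ∀ Z ∈ psdCone P l N, 0 ≤ L (certPoly ord N Z)) (i : Fin (r + 1)) :
    (localizing ord N L i).IsPSD := by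
  refine ⟨?_, fun U => ?_⟩
  · ext k a b
    simp [localizing, Tensor.transpose, gram_comm]
  · rw [← inner_gram, Tensor.inner_comm, inner_localizing]
    by_cases h0 : P.mult i = 0
    · simp [h0]
    · have h := hL (Pi.single i (gram U)) fun j => ?_
      · rw [certPoly_apply, Finset.sum_eq_single i] at h
        · simpa using h
        · intro j _ hj
          simp [hj]
        · simp
      · by_cases hj : j = i
        · subst hj
          simpa [h0] using isPSD_gram U
        · simpa [hj] using IsPSD.zero

theorem exists_separating_functional (hK : (interior P.K).Nonempty) {N : P.Level l}
    {h : MvPolynomial (Fin n) ℝ} (hd : h.totalDegree ≤ 2 * (N : ℕ))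
    (hn : ∀ Z ∈ psdCone P l N, h ≠ certPoly ord N Z) :
    ∃ L : MvPolynomial (Fin n) ℝ →ₗ[ℝ] ℝ, (∀ i, (localizing ord N L i).IsPSD) ∧ L h < 0 := by
  let T := coeffVec n (2 * (N : ℕ)) ∘ₗ certPoly ord N
  have hinj {h h' : MvPolynomial (Fin n) ℝ} (hd : h.totalDegree ≤ 2 * (N : ℕ))
      (hd' : h'.totalDegree ≤ 2 * (N : ℕ))
      (he : coeffVec n (2 * (N : ℕ)) h = coeffVec n (2 * (N : ℕ)) h') : h = h' :=
    ext_of_expo hd hd' fun α hα => congrFun he ⟨α, hα⟩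
  have hclosed : IsClosed (T '' psdCone P l N) := by
    refine isClosed_image_cone (isClosed_psdCone N) (fun Z hZ c hc => smul_mem_psdCone hZ hc) T
      fun Z hZ h0 => eq_zero_of_certPoly_eq_zero (ord := ord) hK hZ ?_
    refine hinj (totalDegree_certPoly_le N Z) (by simp) ?_
    rw [map_zero]
    exact h0
  have hconv : Convex ℝ (T '' psdCone P l N) := by
    rintro _ ⟨Z, hZ, rfl⟩ _ ⟨W, hW, rfl⟩ a b ha hb -
    exact ⟨a • Z + b • W, add_mem_psdCone (smul_mem_psdCone hZ ha) (smul_mem_psdCone hW hb),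
      by simp⟩
  have hcone : ∀ v ∈ T '' psdCone P l N, ∀ c : ℝ, 0 ≤ c → c • v ∈ T '' psdCone P l N := by
    rintro _ ⟨Z, hZ, rfl⟩ c hc
    exact ⟨c • Z, smul_mem_psdCone hZ hc, by simp⟩
  have hzero : 0 ∈ T '' psdCone P l N := ⟨0, fun i => ⟨IsPSD.zero, fun _ => rfl⟩, map_zero T⟩
  have hnot : coeffVec n (2 * (N : ℕ)) h ∉ T '' psdCone P l N := by
    rintro ⟨Z, hZ, he⟩
    exact hn Z hZ (hinj hd (totalDegree_certPoly_le N Z) he.symm)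
  obtain ⟨φ, hφ, hneg⟩ := exists_separating_functional_of_cone hclosed hconv hzero hcone hnot
  exact ⟨φ ∘ₗ coeffVec n (2 * (N : ℕ)),
    isPSD_localizing_of_nonneg fun Z hZ => hφ _ ⟨Z, hZ, rfl⟩, hneg⟩

theorem localizing_add (N : P.Level l) (L M : MvPolynomial (Fin n) ℝ →ₗ[ℝ] ℝ)
    (i : Fin (r + 1)) :
    localizing ord N (L + M) i = localizing ord N L i + localizing ord N M i := rfl

theorem localizing_smul (N : P.Level l) (c : ℝ) (L : MvPolynomial (Fin n) ℝ →ₗ[ℝ] ℝ)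
    (i : Fin (r + 1)) :
    localizing ord N (c • L) i = c • localizing ord N L i := rfl

/-- The greatest lower bound of the dual problem is attained by the primal problem. -/
theorem mem_primalValues_of_isGLB (hf0 : coeff 0 P.f = 0) (hK : (interior P.K).Nonempty)
    {N : P.Level l} {d : ℝ} (hd : IsGLB (dualValues ord N) d) : d ∈ primalValues ord N := by
  by_contra hcon
  rw [mem_primalValues_iff hf0] at hcon
  obtain ⟨L, hpsd, hneg⟩ := exists_separating_functional (ord := ord) (N := N) hK
    ((totalDegree_sub_C_le P.f d).trans N.2.2.1)
    fun Z hZ he => hcon ⟨Z, fun i => (hZ i).1, he⟩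
  have hLd : L P.f < d * L 1 := by
    rw [map_sub, ← mul_one (C d), C_mul', map_smul, smul_eq_mul] at hneg
    linarith
  set t : ℝ := (|L 1| + 1)⁻¹ with ht
  have hpos : 0 < |L 1| + 1 := by positivity
  have htpos : 0 < t := inv_pos.mpr hpos
  have hden : 0 < 1 + t * L 1 := by
    have h1 : t * (|L 1| + 1) = 1 := inv_mul_cancel₀ hpos.ne'
    nlinarith [neg_abs_le (L 1)]
  obtain ⟨v, hv, -, hlt⟩ := hd.exists_between
    (show d < d + t * (d * L 1 - L P.f) by nlinarith)
  obtain ⟨L₀, hL₀, hpsd₀, rfl⟩ := (mem_dualValues_iff hf0).mp hv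
  have hmem : (1 + t * L 1)⁻¹ * (L₀ P.f + t * L P.f) ∈ dualValues ord N := by
    refine (mem_dualValues_iff hf0).mpr ⟨(1 + t * L 1)⁻¹ • (L₀ + t • L), ?_, fun i => ?_, ?_⟩
    · rw [LinearMap.smul_apply, LinearMap.add_apply, LinearMap.smul_apply, hL₀, smul_eq_mul,
        smul_eq_mul, inv_mul_cancel₀ hden.ne']
    · rw [localizing_smul, localizing_add, localizing_smul]
      exact ((hpsd₀ i).add ((hpsd i).smul htpos.le)).smul (inv_nonneg.mpr hden.le)
    · rfl
  have hge := hd.1 hmem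
  rw [inv_mul_eq_div, le_div_iff₀ hden] at hge
  nlinarith

theorem primalSup_eq_dualInf (hf0 : coeff 0 P.f = 0) (hK : (interior P.K).Nonempty)
    (N : P.Level l) : primalSup ord N = dualInf ord N := by
  refine le_antisymm (primalSup_le_dualInf hf0 N) ?_
  obtain ⟨x, hx⟩ := hK.mono interior_subset
  have hmem := eval_mem_dualValues (ord := ord) hf0 N hx
  by_cases hb : BddBelow (dualValues ord N)
  · have hglb := isGLB_csInf ⟨_, hmem⟩ hb
    have hle : dualInf ord N ≤ (sInf (dualValues ord N) : ℝ) := by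
      refine EReal.le_of_forall_lt_iff_le.mp fun c hc => ?_
      obtain ⟨v, hv, -, hvc⟩ := hglb.exists_between (EReal.coe_lt_coe_iff.mp hc)
      exact (sInf_le (Set.mem_image_of_mem _ hv)).trans (EReal.coe_le_coe_iff.mpr hvc.le)
    exact hle.trans (le_sSup (Set.mem_image_of_mem _ (mem_primalValues_of_isGLB hf0 hK hglb)))
  · have hbot : dualInf ord N = ⊥ := by
      refine (EReal.eq_bot_iff_forall_lt _).mpr fun c => ?_
      rw [not_bddBelow_iff] at hb
      obtain ⟨v, hv, hvc⟩ := hb c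
      exact (sInf_le (Set.mem_image_of_mem _ hv)).trans_lt (EReal.coe_lt_coe_iff.mpr hvc)
    rw [hbot]
    exact bot_le

theorem dualInf_le (hf0 : coeff 0 P.f = 0) {pK : ℝ}
    (hpK : pK ∈ (fun x => eval x P.f) '' P.K) (N : P.Level l) : dualInf ord N ≤ pK := by
  obtain ⟨x, hx, rfl⟩ := hpK
  exact sInf_le (Set.mem_image_of_mem _ (eval_mem_dualValues hf0 N hx))

theorem tendsto_primalSup (hf0 : coeff 0 P.f = 0) {pK : ℝ}
    (hpK : pK ∈ (fun x => eval x P.f) '' P.K) (hA : PutinarAssumption ord pK)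
    (h : ord.Nested) : Tendsto (primalSup ord) atTop (𝓝 (pK : EReal)) := by
  refine tendsto_order.mpr ⟨fun c hc => ?_, fun c hc => Eventually.of_forall fun N =>
    ((primalSup_le_dualInf hf0 N).trans (dualInf_le hf0 hpK N)).trans_lt hc⟩
  obtain ⟨v, hcv, hv⟩ := EReal.lt_iff_exists_real_btwn.mp hc
  have hv' : 0 < pK - v := sub_pos.mpr (EReal.coe_lt_coe_iff.mp hv)
  obtain ⟨N, hN⟩ := hA.2 (pK - v) hv'
  have he : P.f - C pK + C (pK - v) = P.f - C v := by rw [C_sub]; ring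
  rw [he] at hN
  filter_upwards [eventually_ge_atTop N] with M hM
  exact hcv.trans_le ((le_sSup (Set.mem_image_of_mem _
    (mem_primalValues_of_hasCertificate hf0 hN))).trans (monotone_primalSup hf0 h hM))

theorem tendsto_dualInf (hf0 : coeff 0 P.f = 0) {pK : ℝ}
    (hpK : pK ∈ (fun x => eval x P.f) '' P.K) (hA : PutinarAssumption ord pK)
    (h : ord.Nested) : Tendsto (dualInf ord) atTop (𝓝 (pK : EReal)) :=
  tendsto_of_tendsto_of_tendsto_of_le_of_le (tendsto_primalSup hf0 hpK hA h)
    tendsto_const_nhds (primalSup_le_dualInf hf0) (dualInf_le hf0 hpK)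

end POP

end

theorem theorem6 {n r : ℕ} (P : POP n r)
    -- the objective function has no constant term
    (hf0 : MvPolynomial.coeff 0 P.f = 0)
    -- `pK` is the minimum of `f` on the feasible set
    (pK : ℝ) (hpK : IsLeast ((fun x => MvPolynomial.eval x P.f) '' P.K) pK)
    -- positive block numbers and monomial vectors
    (l : Fin (r + 1) → ℕ) [∀ i, NeZero (l i)] (ord : P.Arrangement l)
    (hA : POP.PutinarAssumption ord pK) :
    -- (a)
    ((ord.Nested →
        (Monotone (POP.dualInf ord) ∧ Tendsto (POP.dualInf ord) atTop (𝓝 (pK : EReal))) ∧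
        (Monotone (POP.primalSup ord) ∧ Tendsto (POP.primalSup ord) atTop (𝓝 (pK : EReal)))) ∧
      ((interior P.K).Nonempty →
        ∀ᶠ N in atTop, POP.primalSup ord N = POP.dualInf ord N)) ∧
    -- (b)
    (∀ N : P.Level l, POP.HasCertificate ord N (P.f - MvPolynomial.C pK) →
      IsLeast (POP.dualValues ord N) pK ∧ IsGreatest (POP.primalValues ord N) pK ∧
      ∀ x ∈ P.K, MvPolynomial.eval x P.f = pK →
        POP.DualFeasible ord N (momentVector N x) ∧
        ∀ y, POP.DualFeasible ord N y →
          POP.dualObj P N (momentVector N x) ≤ POP.dualObj P N y) := by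
  refine ⟨⟨fun h => ⟨⟨POP.monotone_dualInf hf0 h, POP.tendsto_dualInf hf0 hpK.1 hA h⟩,
    POP.monotone_primalSup hf0 h, POP.tendsto_primalSup hf0 hpK.1 hA h⟩,
    fun hK => Eventually.of_forall fun N => POP.primalSup_eq_dualInf hf0 hK N⟩, fun N hN => ?_⟩
  have hprimal := POP.mem_primalValues_of_hasCertificate hf0 hN
  have hdual : pK ∈ POP.dualValues ord N := by
    obtain ⟨x, hx, hxp⟩ := hpK.1
    have := POP.eval_mem_dualValues (ord := ord) hf0 N hx
    rwa [← hxp]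
  refine ⟨⟨hdual, fun w hw => POP.primal_le_dual hf0 hprimal hw⟩,
    ⟨hprimal, fun v hv => POP.primal_le_dual hf0 hv hdual⟩, fun x hx hxp => ⟨?_, fun y hy => ?_⟩⟩
  · rw [POP.momentVector_eq, POP.dualFeasible_moments_iff (by simp [POP.evalₗ_apply])]
    exact POP.isPSD_localizing_evalₗ N hx
  · rw [POP.momentVector_eq, POP.dualObj_moments hf0, POP.evalₗ_apply, hxp]
    exact POP.primal_le_dual hf0 hprimal ⟨y, hy, rfl⟩
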